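/- A binary sequence of length $N\ge 1$ is $a=(a(0),\dots,a(N-1))$ with all $a(j)=\pm1$; its periodic autocorrelation function is $\tilde\varphi_a(i)=\sum_{j=0}^{N-1}a(j)\,a((i+j)\bmod N)$, $0\le i<N$. A $PCS_p^N$ ($p\ge1$) is a family of $p$ binary sequences of length $N$, not necessarily distinct, whose periodic autocorrelation functions sum to a $\delta$-function, i.e. $\sum_{r=1}^p\tilde\varphi_{a_r}(i)=0$ for $0<i<N$. Subsets $X_1,\dots,X_p\subseteq\mathbf Z/N$ are supplementary difference sets (SDS) with parameters $(N;k_1,\dots,k_p;\lambda)$ if $|X_r|=k_r$ for all $r$ and, for every nonzero $m\in\mathbf Z/N$, the total number over $r=1,\dots,p$ of ordered pairs $(i,j)\in X_r\times X_r$ with $i-j=m$ is $\lambda$. **Theorem (existence of $PCS_p^N$ for $p\le12$, $N\le50$).** 1. If $p\ge1$ is divisible by $4$, then $PCS_p^N$ exist for all $1\le N\le50$. For every $p\ge1$, $PCS_p^1$ exist. 2. If $p$ is not divisible by $4$, $N>1$ and $PCS_p^N$ exist, then $N$ is even. 3. For $p\le12$ not divisible by $4$ and even $N$ with $2\le N\le50$,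 $PCS_p^N$ exist if and only if $N$ is listed in row $p$ of the following table, either as a bullet entry or as a circle entry (all other entries of the table are blank: no $PCS_p^N$ exist). | $p$ | bullet entries $N$ | circle entries $N$ | |---|---|---| | 1 | 4 | none | | 2 | 2, 8, 10, 16, 20, 26, 32, 34, 40, 50 | 4 | | 3 | 8, 12, 16, 24, 28, 32, 36, 40, 44, 48 | 4 | | 5 | 12, 20, 24, 28, 36, 44, 48 | 4, 8, 16, 32, 40 | | 6 | 6, 14, 18, 22, 30, 38, 42, 46 | all other even $N\le50$ | | 7 | none | all multiples of 4 up to 48 | | 9 | none | all multiples of 4 up to 48 | | 10 | none | all even $N\le50$ | | 11 | none | all multiples of 4 up to 48 | Moreover, among the non-blank entries $(p,N)$, the circle entries are exactly those for which $p$ can be written as a sum of integers $q<p$ (repetitions allowed) such that each $q$ is $4$ or $(q,N)$ is a bullet entry, so that a $PCS_p^N$ arises by combining families $PCS_q^N$; a bullet entry admits no such decomposition. 4. There exist supplementary difference sets with parameters $(36;15,15,15;18)$, $(40;19,18,15;22)$, $(44;20,20,17;24)$, $(48;24,24,18;30)$, $(44;21,20,19,18,17;40)$, $(48;23,21,21,20,19;44)$,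 $(38;18,17,16,16,16,14;40)$, $(42;19,18,18,18,17,17;44)$ and $(46;21,21,21,21,21,16;52)$. -/

import Mathlib

namespace PeriodicComplementary

/-- A binary sequence of length `N`: every term is `1` or `-1`. -/
def IsBinary {N : ℕ} (a : Fin N → ℤ) : Prop :=
  ∀ j, a j = 1 ∨ a j = -1

/-- The periodic autocorrelation function; addition in `Fin N` is addition modulo `N`. -/
def pacf {N : ℕ} (a : Fin N → ℤ) (i : Fin N) : ℤ :=
  ∑ j, a j * a (i + j)

/-- A family of `p` periodic complementary binary sequences of length `N`: the sum of the periodic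
autocorrelation functions vanishes at every nonzero shift (at shift `0` it is always `p * N`).
The members of the family need not be distinct. -/
def IsPCS {p N : ℕ} (a : Fin p → Fin N → ℤ) : Prop :=
  (∀ r, IsBinary (a r)) ∧ ∀ i : Fin N, (i : ℕ) ≠ 0 → ∑ r, pacf (a r) i = 0

/-- `PCS_p^N` exist. -/
def ExistsPCS (p N : ℕ) : Prop :=
  ∃ a : Fin p → Fin N → ℤ, IsPCS a

/-- The number of ordered pairs of elements of `X` with difference `m` modulo `N`. -/
def nu {N : ℕ} (X : Finset (Fin N)) (m : Fin N) : ℕ :=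
  ((X ×ˢ X).filter fun ij => ij.1 - ij.2 = m).card

/-- Supplementary difference sets in `ℤ / N` with parameters `(N; k₁, …, kₚ; l)`. -/
def IsSDS {p N : ℕ} (X : Fin p → Finset (Fin N)) (k : Fin p → ℕ) (l : ℕ) : Prop :=
  (∀ r, (X r).card = k r) ∧ ∀ m : Fin N, (m : ℕ) ≠ 0 → ∑ r, nu (X r) m = l

/-- There are supplementary difference sets with parameters `(N; k₁, …, kₚ; l)`. -/
def ExistsSDS (N : ℕ) {p : ℕ} (k : Fin p → ℕ) (l : ℕ) : Prop :=
  ∃ X : Fin p → Finset (Fin N), IsSDS X k l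

/-- The three kinds of entries of the table. -/
inductive Entry
  | blank
  | bullet
  | circle
  deriving DecidableEq

/-- The columns with a bullet in row `p` of the table. -/
def bulletColumns : ℕ → List ℕ
  | 1 => [4]
  | 2 => [2, 8, 10, 16, 20, 26, 32, 34, 40, 50]
  | 3 => [8, 12, 16, 24, 28, 32, 36, 40, 44, 48]
  | 5 => [12, 20, 24, 28, 36, 44, 48]
  | 6 => [6, 14, 18, 22, 30, 38, 42, 46]
  | _ => []

/-- The columns with a circle in row `p` of the table. -/
def circleColumns : ℕ → List ℕ
  | 2 => [4]
  | 3 => [4]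
  | 5 => [4, 8, 16, 32, 40]
  | 6 => [2, 4, 8, 10, 12, 16, 20, 24, 26, 28, 32, 34, 36, 40, 44, 48, 50]
  | 7 => [4, 8, 12, 16, 20, 24, 28, 32, 36, 40, 44, 48]
  | 9 => [4, 8, 12, 16, 20, 24, 28, 32, 36, 40, 44, 48]
  | 10 => [2, 4, 6, 8, 10, 12, 14, 16, 18, 20, 22, 24, 26, 28, 30, 32, 34, 36, 38, 40, 42, 44,
      46, 48, 50]
  | 11 => [4, 8, 12, 16, 20, 24, 28, 32, 36, 40, 44, 48]
  | _ => []

/-- The entry of the table in row `p` and column `N`; the table has the rows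
`p = 1, 2, 3, 5, 6, 7, 9, 10, 11` and the columns `N = 2, 4, …, 50`. -/
def tableEntry (p N : ℕ) : Entry :=
  if N ∈ bulletColumns p then .bullet else if N ∈ circleColumns p then .circle else .blank

/-- `p` is a sum of numbers `q < p`, repetitions allowed, each of which is `4` or the row of a
bullet entry in column `N`. -/
def IsCombination (p N : ℕ) : Prop :=
  ∃ s : Multiset ℕ, s.sum = p ∧ ∀ q ∈ s, q < p ∧ (q = 4 ∨ tableEntry q N = .bullet)

end PeriodicComplementary

open PeriodicComplementary

/-!
Existence is a matter of exhibiting supplementary difference sets, since their signed indicator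
functions are periodic complementary; the other families come from concatenating families and from
interleaving pairs of sequences, which doubles the length.

For nonexistence, take Fourier transforms. The family `a` being complementary means that the norms
of the character sums of its members add up to `p * N` at every `N`-th root of unity. At `1` this
writes `p * N` as a sum of `p` squares, and modulo `4` already the autocorrelations give
`4 ∣ p * N`. Among the blank entries this leaves `(1, 16)`, `(1, 36)`, `(2, 18)` and `(2, 36)`, and
the last three come down to `(2, 36)`. For the remaining two, let `ζ` be a root of unity of order a
power of a prime `q`. As `q` is totally ramified in `ℤ[ζ]`, complex conjugation acts trivially
modulo the prime above it, so a norm is a square there. If the sum of `p` squares is anisotropic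
modulo `q`, a descent then shows that `q ^ (2 * k) ∣ p * N` forces `q ^ k` to divide each character
sum at `ζ` and, when `q` is odd and `N` even, at `-ζ`, hence also its parts over the even and over
the odd indices. But the coefficients on the powers of `ζ` are so small against `q ^ k` that such
divisibility makes all of these sums vanish, and then so does `p * N`.
-/

namespace PeriodicComplementary

/-! ### Character sums -/

section CharSum

variable {R : Type*} [CommRing R] {N : ℕ}

/-- The Fourier transform of the sequence `a` at `ξ`. It is a character sum of `ℤ / N` when
`ξ ^ N = 1`; the values lie in an arbitrary ring so that `ξ` may be an algebraic integer. -/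
def charSum (a : Fin N → ℤ) (ξ : R) : R :=
  ∑ j, (a j : R) * ξ ^ (j : ℕ)

theorem charSum_one (a : Fin N → ℤ) : charSum a (1 : R) = ((∑ j, a j : ℤ) : R) := by
  simp [charSum]

theorem map_charSum {R' : Type*} [CommRing R'] (σ : R →+* R') (a : Fin N → ℤ) (ξ : R) :
    σ (charSum a ξ) = charSum a (σ ξ) := by
  simp [charSum]

theorem two_mul_sum_parity (a : Fin N → ℤ) (ξ : R) (e : Fin 2) :
    2 * ∑ j with j.val % 2 = e.val, (a j : R) * ξ ^ (j : ℕ) =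
      charSum a ξ + (-1) ^ (e : ℕ) * charSum a (-ξ) := by
  rw [charSum, charSum, Finset.mul_sum, Finset.mul_sum, ← Finset.sum_add_distrib, Finset.sum_filter]
  refine Finset.sum_congr rfl fun j _ => ?_
  rw [neg_pow ξ, neg_one_pow_eq_pow_mod_two j.val]
  rcases Nat.mod_two_eq_zero_or_one j with hj | hj <;> rw [hj] <;> fin_cases e <;> simp <;> ring

theorem sum_eq_charSum_residues (a : Fin N → ℤ) {n : ℕ} [NeZero n] {ξ : R} (hn : ξ ^ n = 1)
    (S : Finset (Fin N)) :
    ∑ j ∈ S, (a j : R) * ξ ^ (j : ℕ) =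
      charSum (fun k : Fin n => ∑ j ∈ S with j.val % n = k.val, a j) ξ := by
  rw [charSum, ← Finset.sum_fiberwise S fun j => Fin.ofNat n j]
  refine Finset.sum_congr rfl fun k _ => ?_
  rw [Int.cast_sum, Finset.sum_mul]
  refine Finset.sum_congr (by simp [Fin.ext_iff]) fun j hj => ?_
  rw [← (Finset.mem_filter.1 hj).2, ← pow_eq_pow_mod _ hn]

theorem pow_val_add {ξ : R} (hN : ξ ^ N = 1) (i j : Fin N) :
    ξ ^ ((i + j : Fin N) : ℕ) = ξ ^ (i : ℕ) * ξ ^ (j : ℕ) := by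
  rw [Fin.val_add, ← pow_add, ← pow_eq_pow_mod _ hN]

theorem charSum_mul_inv_pow [NeZero N] (a : Fin N → ℤ) {ξ ξ' : R} (hN : ξ ^ N = 1)
    (hξ : ξ * ξ' = 1) (j : Fin N) :
    charSum a ξ * ξ' ^ (j : ℕ) = charSum (fun i => a (i + j)) ξ := by
  rw [charSum, ← Equiv.sum_comp (Equiv.addRight j), Finset.sum_mul]
  refine Finset.sum_congr rfl fun i _ => ?_
  rw [Equiv.coe_addRight, pow_val_add hN, mul_assoc, mul_assoc, ← mul_pow, hξ, one_pow, mul_one]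

theorem charSum_eq_zero_of_periodic [IsDomain R] [NeZero N] {a : Fin N → ℤ} {ξ : R}
    (hN : ξ ^ N = 1) {j : Fin N} (hj : ξ ^ (j : ℕ) ≠ 1) (ha : ∀ i, a (i + j) = a i) :
    charSum a ξ = 0 := by
  have hξ : ξ * ξ ^ (N - 1) = 1 := by rw [mul_pow_sub_one (NeZero.ne N), hN]
  have hshift := charSum_mul_inv_pow a hN hξ j
  simp only [ha] at hshift
  refine (mul_right_eq_self₀.1 hshift).resolve_left fun h => hj ?_
  simpa [hξ, h] using (mul_pow ξ (ξ ^ (N - 1)) j).symm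

/-- The Wiener–Khinchin identity. -/
theorem charSum_mul_charSum_inv [NeZero N] (a : Fin N → ℤ) {ξ ξ' : R} (hN : ξ ^ N = 1)
    (hξ : ξ * ξ' = 1) : charSum a ξ * charSum a ξ' = charSum (pacf a) ξ :=
  calc charSum a ξ * charSum a ξ'
    _ = ∑ j, (a j : R) * (charSum a ξ * ξ' ^ (j : ℕ)) := by
      rw [charSum, charSum, Finset.mul_sum]
      exact Finset.sum_congr rfl fun j _ => by ring
    _ = ∑ j, ∑ i, (a j * a (i + j) : R) * ξ ^ (i : ℕ) := by
      simp only [charSum_mul_inv_pow a hN hξ]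
      simp only [charSum, Finset.mul_sum, mul_assoc]
    _ = charSum (pacf a) ξ := by
      rw [Finset.sum_comm]
      simp only [charSum, pacf, Int.cast_sum, Int.cast_mul, Finset.sum_mul]

end CharSum

theorem IsBinary.sq_eq_one {N : ℕ} {a : Fin N → ℤ} (ha : IsBinary a) (j : Fin N) :
    a j ^ 2 = 1 :=
  sq_eq_one_iff.2 (ha j)

theorem IsBinary.pacf_zero {N : ℕ} [NeZero N] {a : Fin N → ℤ} (ha : IsBinary a) :
    pacf a 0 = N := by
  simp [pacf, ← sq, ha.sq_eq_one]

theorem IsPCS.sum_charSum_mul_charSum_inv {R : Type*} [CommRing R] {p N : ℕ} [NeZero N]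
    {a : Fin p → Fin N → ℤ} (ha : IsPCS a) {ξ ξ' : R} (hN : ξ ^ N = 1) (hξ : ξ * ξ' = 1) :
    ∑ r, charSum (a r) ξ * charSum (a r) ξ' = (p * N : ℕ) := by
  simp only [charSum_mul_charSum_inv _ hN hξ]
  simp only [charSum]
  rw [Finset.sum_comm, Finset.sum_eq_single 0]
  · simp [(ha.1 _).pacf_zero]
  · intro i _ hi
    rw [← Finset.sum_mul, ← Int.cast_sum, ha.2 i (Fin.val_ne_zero_iff.2 hi), Int.cast_zero,
      zero_mul]
  · simp

theorem IsPCS.exists_charSum_ne_zero {R : Type*} [CommRing R] [CharZero R] {p N : ℕ} [NeZero p]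
    [NeZero N] {a : Fin p → Fin N → ℤ} (ha : IsPCS a) {ξ : R} (hN : ξ ^ N = 1) :
    ∃ r, charSum (a r) ξ ≠ 0 := by
  by_contra! h
  have hξ : ξ * ξ ^ (N - 1) = 1 := by rw [mul_pow_sub_one (NeZero.ne N), hN]
  have hsum := ha.sum_charSum_mul_charSum_inv hN hξ
  simp only [h, zero_mul, Finset.sum_const_zero] at hsum
  exact NeZero.ne (p * N) (Nat.cast_eq_zero.1 hsum.symm)

theorem ExistsPCS.exists_sum_sq_eq {p N : ℕ} [NeZero N] (h : ExistsPCS p N) :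
    ∃ x : Fin p → ℕ, ∑ r, x r ^ 2 = p * N := by
  obtain ⟨a, ha⟩ := h
  refine ⟨fun r => (∑ j, a r j).natAbs, ?_⟩
  zify
  simpa [charSum_one, ← sq] using
    ha.sum_charSum_mul_charSum_inv (one_pow (M := ℤ) N) (mul_one 1)

/-! ### Descent along a totally ramified prime -/

/-- The form `∑ x i ^ 2` indexed by `ι` is anisotropic modulo `p`. This is what makes a descent on
sums of norms possible. -/
def SumSqAnisotropic (ι : Type*) [Fintype ι] (p : ℕ) : Prop :=
  ∀ x : ι → ZMod p, ∑ i, x i ^ 2 = 0 → x = 0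

theorem sumSqAnisotropic_of_unique (ι : Type*) [Fintype ι] [Unique ι] (p : ℕ)
    [IsReduced (ZMod p)] : SumSqAnisotropic ι p := fun x hx => by
  rw [Fintype.sum_unique] at hx
  exact funext fun i => by rw [Unique.eq_default i, eq_zero_of_pow_eq_zero hx, Pi.zero_apply]

theorem SumSqAnisotropic.dvd_of_dvd_sum {ι : Type*} [Fintype ι] {p : ℕ}
    (h : SumSqAnisotropic ι p) {c : ι → ℤ} (hc : (p : ℤ) ∣ ∑ i, c i ^ 2) (i : ι) :
    (p : ℤ) ∣ c i := by
  rw [← ZMod.intCast_zmod_eq_zero_iff_dvd] at hc ⊢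
  exact congrFun (h (fun i => c i) (by exact_mod_cast hc)) i

/-- Modulo `π`, which `σ` fixes up to a unit, every `x * σ x` is the square of an integer. -/
theorem pow_dvd_of_pow_dvd_sum_mul_map {R ι : Type*} [CommRing R] [IsDomain R] [Fintype ι]
    {p : ℕ} {π : R} {σ : R →+* R} (hι : SumSqAnisotropic ι p) (hπ : π ≠ 0)
    (hσ : Associated π (σ π)) (hres : ∀ x : R, ∃ c : ℤ, π ∣ x - c)
    (hp : ∀ c : ℤ, π ∣ (c : R) ↔ (p : ℤ) ∣ c) (n : ℕ) {α : ι → R}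
    (h : π ^ (2 * n) ∣ ∑ i, α i * σ (α i)) (i : ι) : π ^ n ∣ α i := by
  induction n generalizing α with
  | zero => simp
  | succ n ih =>
    choose c hc using fun i => hres (α i)
    have hcσ (i : ι) : π ∣ σ (α i) - c i := by
      simpa using hσ.dvd.trans (map_dvd σ (hc i))
    have hsq : π ∣ ((∑ i, c i ^ 2 : ℤ) : R) := by
      rw [← dvd_sub_right ((dvd_pow_self π (by lia)).trans h)]
      push_cast
      rw [← Finset.sum_sub_distrib]
      refine Finset.dvd_sum fun i _ => ?_
      convert ((hc i).mul_right (σ (α i))).add ((hcσ i).mul_left (c i : R)) using 1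
      ring
    have hα (i : ι) : π ∣ α i :=
      (dvd_sub_left ((hp _).2 (hι.dvd_of_dvd_sum ((hp _).1 hsq) i))).1 (hc i)
    choose β hβ using hα
    obtain ⟨u, hu⟩ := hσ
    have hsum : ∑ i, α i * σ (α i) = π ^ 2 * (u * ∑ i, β i * σ (β i)) := by
      simp only [hβ, map_mul, ← hu, Finset.mul_sum]
      exact Finset.sum_congr rfl fun i _ => by ring
    rw [hsum, mul_add, pow_add, mul_comm (π ^ (2 * n)), mul_one,
      mul_dvd_mul_iff_left (pow_ne_zero 2 hπ), u.isUnit.dvd_mul_left] at h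
    rw [pow_succ', hβ]
    exact mul_dvd_mul_left π (ih h)

theorem dvd_of_dvd_charSum_gen {R : Type*} [CommRing R] {n : ℕ} (B : PowerBasis ℤ R) {M : ℤ}
    {c : Fin n → ℤ} (hc : ∀ i : Fin n, B.dim ≤ i → c i = 0) (h : (M : R) ∣ charSum c B.gen)
    (i : Fin n) : M ∣ c i := by
  rcases le_or_gt B.dim i with hi | hi
  · simp [hc i hi]
  obtain ⟨y, hy⟩ := h
  refine ⟨B.basis.repr y ⟨i, hi⟩, ?_⟩
  have hpow (j : Fin n) (hj : (j : ℕ) < B.dim) :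
      B.basis.repr (B.gen ^ (j : ℕ)) ⟨i, hi⟩ = if j = i then 1 else 0 := by
    rw [← B.basis_eq_pow ⟨j, hj⟩, B.basis.repr_self, Finsupp.single_apply]
    simp [Fin.ext_iff]
  calc c i = ∑ j, c j * B.basis.repr (B.gen ^ (j : ℕ)) ⟨i, hi⟩ := by
        rw [Finset.sum_congr rfl fun j _ => ?_, Finset.sum_ite_eq' Finset.univ i c]
        · simp
        · rcases le_or_gt B.dim j with hj | hj
          · simp [hc j hj]
          · simp [hpow j hj]
    _ = B.basis.repr (charSum c B.gen) ⟨i, hi⟩ := by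
        simp only [charSum, ← zsmul_eq_mul, map_sum, map_zsmul, Finsupp.coe_finsetSum,
          Finsupp.coe_smul, Finset.sum_apply, Pi.smul_apply, smul_eq_mul]
    _ = M * B.basis.repr y ⟨i, hi⟩ := by
        rw [hy, ← zsmul_eq_mul, map_zsmul, Finsupp.smul_apply, smul_eq_mul]

/-! ### Cyclotomic integers of prime power order -/

section Cyclotomic

open NumberField Polynomial

variable {K : Type*} [Field K] [NumberField K]

theorem exists_ringHom_toInteger_mul_eq_one {n : ℕ} [NeZero n] [IsCyclotomicExtension {n} ℚ K]
    {ζ : K} (hζ : IsPrimitiveRoot ζ n) :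
    ∃ σ : 𝓞 K →+* 𝓞 K, hζ.toInteger * σ hζ.toInteger = 1 := by
  have hζ' := hζ.toInteger_isPrimitiveRoot
  let B := hζ.integralPowerBasis
  have hinv : hζ.toInteger * hζ.toInteger ^ (n - 1) = 1 := by
    rw [mul_pow_sub_one (NeZero.ne n), hζ'.pow_eq_one]
  have hroot : aeval (hζ.toInteger ^ (n - 1)) (minpoly ℤ B.gen) = 0 := by
    have hmin : cyclotomic n ℤ = minpoly ℤ hζ.toInteger :=
      (cyclotomic_eq_minpoly hζ (NeZero.pos n)).trans (RingOfIntegers.minpoly_coe hζ.toInteger)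
    rw [hζ.integralPowerBasis_gen, ← hmin, aeval_def, eval₂_eq_eval_map, map_cyclotomic]
    refine IsPrimitiveRoot.isRoot_cyclotomic (NeZero.pos n) (hζ'.pow_of_coprime _ ?_)
    exact (Nat.coprime_self_sub_left NeZero.one_le).2 (Nat.coprime_one_left n)
  refine ⟨(B.lift _ hroot : 𝓞 K →+* 𝓞 K), ?_⟩
  rw [← hinv]
  congr 1
  simpa [B] using B.lift_gen _ hroot

theorem toInteger_sub_one_dvd_sub_intCast {n : ℕ} [NeZero n] [IsCyclotomicExtension {n} ℚ K]
    {ζ : K} (hζ : IsPrimitiveRoot ζ n) (x : 𝓞 K) : ∃ c : ℤ, hζ.toInteger - 1 ∣ x - c := by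
  obtain ⟨f, hf⟩ := hζ.integralPowerBasis.exists_eq_aeval' x
  refine ⟨f.eval 1, ?_⟩
  have := sub_dvd_eval_sub hζ.toInteger 1 (f.map (Int.castRingHom (𝓞 K)))
  simpa [hf, aeval_def, eval₂_eq_eval_map] using this

variable {p l : ℕ} [Fact p.Prime] [IsCyclotomicExtension {p ^ (l + 1)} ℚ K] {ζ : K}
  (hζ : IsPrimitiveRoot ζ (p ^ (l + 1)))

theorem associated_toInteger_sub_one_pow :
    Associated ((hζ.toInteger - 1) ^ Module.finrank ℚ K) (p : 𝓞 K) := by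
  rw [← Ideal.span_singleton_eq_span_singleton, ← Ideal.span_singleton_pow,
    ← IsCyclotomicExtension.Rat.map_eq_span_zeta_sub_one_pow p l hζ, Ideal.map_span]
  simp

theorem natCast_pow_dvd_of_dvd_sum_mul_map {ι : Type*} [Fintype ι] (hι : SumSqAnisotropic ι p)
    {σ : 𝓞 K →+* 𝓞 K} (hσ : hζ.toInteger * σ hζ.toInteger = 1) {k : ℕ} {α : ι → 𝓞 K}
    (h : (p : 𝓞 K) ^ (2 * k) ∣ ∑ i, α i * σ (α i)) (i : ι) : (p : 𝓞 K) ^ k ∣ α i := by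
  have hπ := associated_toInteger_sub_one_pow hζ
  have hσπ : Associated (hζ.toInteger - 1) (σ (hζ.toInteger - 1)) := by
    refine ⟨-Units.mkOfMulEqOne _ _ ((mul_comm _ _).trans hσ), ?_⟩
    rw [Units.val_neg, Units.val_mkOfMulEqOne, map_sub, map_one]
    linear_combination -hσ
  rw [← hπ.pow_pow.dvd_iff_dvd_left, ← pow_mul, mul_left_comm] at h
  rw [← hπ.pow_pow.dvd_iff_dvd_left, ← pow_mul]
  exact pow_dvd_of_pow_dvd_sum_mul_map hι hζ.zeta_sub_one_prime.ne_zero hσπ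
    (toInteger_sub_one_dvd_sub_intCast hζ)
    (fun _ => IsCyclotomicExtension.Rat.zeta_sub_one_dvd_intCast_iff p l hζ) _ h i

/-- Among the `p ^ (l + 1)` powers of `ζ`, those with exponents in a class modulo `p ^ l` sum to
zero. Subtracting the last coefficient of each class leaves an expansion in the power basis. -/
theorem charSum_eq_zero_of_dvd {M : ℤ} {c : Fin (p ^ (l + 1)) → ℤ}
    (hM : (M : 𝓞 K) ∣ charSum c hζ.toInteger) (hc : ∀ i j, M ∣ c i - c j → c i = c j) :
    charSum c hζ.toInteger = 0 := by
  have hp := (Fact.out : p.Prime)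
  have hq : p ^ l < p ^ (l + 1) := Nat.pow_lt_pow_right hp.one_lt l.lt_succ_self
  have hsplit : p ^ l * (p - 1) + p ^ l = p ^ (l + 1) := by
    rw [← Nat.mul_succ, Nat.succ_eq_add_one, Nat.sub_add_cancel hp.one_le, pow_succ]
  have hmod (i : ℕ) : i % p ^ l < p ^ l := Nat.mod_lt i (NeZero.pos _)
  let last (i : Fin (p ^ (l + 1))) : Fin (p ^ (l + 1)) :=
    ⟨p ^ l * (p - 1) + i % p ^ l, by have := hmod i; lia⟩
  have hζ' := hζ.toInteger_isPrimitiveRoot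
  have hlast : charSum (c ∘ last) hζ.toInteger = 0 := by
    refine charSum_eq_zero_of_periodic hζ'.pow_eq_one (j := ⟨p ^ l, hq⟩)
      (hζ'.pow_ne_one_of_pos_of_lt (NeZero.ne _) hq) fun i => congrArg c (Fin.ext ?_)
    simp [last, Fin.val_add, Nat.mod_mod_of_dvd, pow_succ]
  have hsub : charSum c hζ.toInteger = charSum (fun i => c i - c (last i)) hζ.toInteger := by
    rw [← sub_zero (charSum c _), ← hlast]
    simp [charSum, sub_mul]
  have hdvd : ∀ i, M ∣ c i - c (last i) := by
    refine dvd_of_dvd_charSum_gen hζ.integralPowerBasis (fun i hi => ?_) ?_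
    · rw [hζ.integralPowerBasis_dim, Nat.totient_prime_pow_succ hp] at hi
      rw [sub_eq_zero]
      refine congrArg c (Fin.ext ?_)
      have : (i : ℕ) - p ^ l * (p - 1) = i % p ^ l := by
        rw [← Nat.sub_mul_mod hi, Nat.mod_eq_of_lt]
        lia
      simp only [last]
      lia
    · rwa [hζ.integralPowerBasis_gen, ← hsub]
  rw [hsub]
  simp [charSum, sub_eq_zero.2 (hc _ _ (hdvd _))]

end Cyclotomic

/-! ### Divisibility obstructions -/

theorem card_filter_val_eq_count (N : ℕ) (q : ℕ → Prop) [DecidablePred q] :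
    (Finset.univ.filter fun j : Fin N => q j).card = Nat.count q N := by
  rw [Nat.count_eq_card_filter_range, Finset.card_filter, Finset.card_filter,
    Fin.sum_univ_eq_sum_range fun j => if q j then 1 else 0]

theorem card_filter_mod_eq {m u k : ℕ} (hk : k < m) :
    (Finset.univ.filter fun j : Fin (m * u) => j.val % m = k).card = u := by
  rw [card_filter_val_eq_count _ fun j => j % m = k]
  simpa [Nat.ModEq, Nat.mod_eq_of_lt hk, Nat.mul_div_cancel_left u hk.bot_lt] using
    Nat.count_modEq_card (m * u) hk.bot_lt k

theorem card_filter_parity_mod_eq {n v k : ℕ} (hn : Odd n) (hk : k < n) (e : Fin 2) :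
    ((Finset.univ.filter fun j : Fin (2 * n * v) => j.val % 2 = e.val).filter
      fun j => j.val % n = k).card = v := by
  obtain ⟨t, ht2, htn⟩ := Nat.chineseRemainder (Nat.coprime_two_left.2 hn) e k
  have ht : t % (2 * n) < 2 * n := Nat.mod_lt _ (by lia)
  refine Eq.trans ?_ (card_filter_mod_eq ht)
  rw [Finset.filter_filter]
  refine congrArg Finset.card (Finset.filter_congr fun j _ => ?_)
  rw [← Nat.mod_eq_of_lt e.2, ← Nat.mod_eq_of_lt hk]
  exact (and_congr ⟨(·.trans ht2.symm), (·.trans ht2)⟩ ⟨(·.trans htn.symm), (·.trans htn)⟩).trans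
    (Nat.modEq_and_modEq_iff_modEq_mul (Nat.coprime_two_left.2 hn))

theorem IsBinary.abs_sum_le {N : ℕ} {a : Fin N → ℤ} (ha : IsBinary a) (S : Finset (Fin N)) :
    |∑ j ∈ S, a j| ≤ S.card := by
  refine (Finset.abs_sum_le_sum_abs _ _).trans_eq ?_
  simp [(abs_eq zero_le_one).2 (ha _)]

theorem IsBinary.two_dvd_sum_sub_card {N : ℕ} {a : Fin N → ℤ} (ha : IsBinary a)
    (S : Finset (Fin N)) : 2 ∣ ∑ j ∈ S, a j - S.card := by
  have h : ∑ j ∈ S, a j - S.card = ∑ j ∈ S, (a j - 1) := by simp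
  rw [h]
  refine Finset.dvd_sum fun j _ => ?_
  rcases ha j with hj | hj <;> simp [hj]

section Cyclotomic

open NumberField

section

variable {K : Type*} [Field K] [NumberField K] {p l : ℕ} [Fact p.Prime]
  [IsCyclotomicExtension {p ^ (l + 1)} ℚ K] {ζ : K} (hζ : IsPrimitiveRoot ζ (p ^ (l + 1)))

/-- The sum is `∑ c k * ζ ^ k`, where the `c k` have the parity of `v` and lie between `-v` and
`v`, so that two of them are equal as soon as they are congruent modulo `M`. -/
theorem IsBinary.sum_eq_zero_of_dvd {N v M : ℕ} {a : Fin N → ℤ} (ha : IsBinary a)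
    {S : Finset (Fin N)}
    (hS : ∀ k < p ^ (l + 1), (S.filter fun j => j.val % p ^ (l + 1) = k).card = v)
    (hv : 2 * v < Nat.lcm 2 M)
    (hM : (M : 𝓞 K) ∣ ∑ j ∈ S, (a j : 𝓞 K) * hζ.toInteger ^ (j : ℕ)) :
    ∑ j ∈ S, (a j : 𝓞 K) * hζ.toInteger ^ (j : ℕ) = 0 := by
  rw [sum_eq_charSum_residues a hζ.toInteger_isPrimitiveRoot.pow_eq_one] at hM ⊢
  refine charSum_eq_zero_of_dvd hζ (M := M) (by exact_mod_cast hM) fun i j hij => ?_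
  have hpar := dvd_sub (ha.two_dvd_sum_sub_card (S.filter fun x => x.val % p ^ (l + 1) = i))
    (ha.two_dvd_sum_sub_card (S.filter fun x => x.val % p ^ (l + 1) = j))
  have hi := ha.abs_sum_le (S.filter fun x => x.val % p ^ (l + 1) = i)
  have hj := ha.abs_sum_le (S.filter fun x => x.val % p ^ (l + 1) = j)
  rw [hS _ i.2] at hi hpar
  rw [hS _ j.2] at hj hpar
  rw [sub_sub_sub_cancel_right] at hpar
  have hlcm := Int.coe_lcm_dvd hpar hij
  rw [← sub_eq_zero]
  refine Int.eq_zero_of_abs_lt_dvd hlcm ((abs_sub _ _).trans_lt ?_)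
  rw [show Int.lcm 2 M = Nat.lcm 2 M from rfl]
  lia

theorem IsPCS.natCast_pow_dvd_charSum {r N k : ℕ} [NeZero N] {a : Fin r → Fin N → ℤ}
    (ha : IsPCS a) (hr : SumSqAnisotropic (Fin r) p) (hk : p ^ (2 * k) ∣ r * N)
    {σ : 𝓞 K →+* 𝓞 K} (hσ : hζ.toInteger * σ hζ.toInteger = 1) {ξ : 𝓞 K} (hN : ξ ^ N = 1)
    (hξ : ξ * σ ξ = 1) (i : Fin r) : (p : 𝓞 K) ^ k ∣ charSum (a i) ξ := by
  refine natCast_pow_dvd_of_dvd_sum_mul_map hζ hr hσ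
    (α := fun i => charSum (a i) ξ) ?_ i
  simp only [map_charSum, ha.sum_charSum_mul_charSum_inv hN hξ]
  exact_mod_cast Nat.cast_dvd_cast (α := 𝓞 K) hk

end

theorem ExistsPCS.lcm_two_pow_le {p l r u k : ℕ} [Fact p.Prime] [NeZero r] [NeZero u]
    (hr : SumSqAnisotropic (Fin r) p) (hk : p ^ (2 * k) ∣ r * (p ^ (l + 1) * u))
    (h : ExistsPCS r (p ^ (l + 1) * u)) : Nat.lcm 2 (p ^ k) ≤ 2 * u := by
  obtain ⟨a, ha⟩ := h
  let K := CyclotomicField (p ^ (l + 1)) ℚ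
  have : IsCyclotomicExtension {p ^ (l + 1)} ℚ K := CyclotomicField.isCyclotomicExtension _ ℚ
  have hζ := IsCyclotomicExtension.zeta_spec (p ^ (l + 1)) ℚ K
  obtain ⟨σ, hσ⟩ := exists_ringHom_toInteger_mul_eq_one hζ
  have hN : hζ.toInteger ^ (p ^ (l + 1) * u) = 1 := by
    rw [pow_mul, hζ.toInteger_isPrimitiveRoot.pow_eq_one, one_pow]
  obtain ⟨i, hi⟩ := ha.exists_charSum_ne_zero hN
  contrapose! hi with hlt
  refine (ha.1 i).sum_eq_zero_of_dvd hζ (fun _ => card_filter_mod_eq) hlt ?_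
  exact_mod_cast ha.natCast_pow_dvd_charSum hζ hr hk hσ hN hσ i

theorem ExistsPCS.pow_le_of_odd {p l r v k : ℕ} [Fact p.Prime] [NeZero r] [NeZero v] (hp2 : Odd p)
    (hr : SumSqAnisotropic (Fin r) p) (hk : p ^ (2 * k) ∣ r * (2 * p ^ (l + 1) * v))
    (h : ExistsPCS r (2 * p ^ (l + 1) * v)) : p ^ k ≤ v := by
  obtain ⟨a, ha⟩ := h
  let K := CyclotomicField (p ^ (l + 1)) ℚ
  have : IsCyclotomicExtension {p ^ (l + 1)} ℚ K := CyclotomicField.isCyclotomicExtension _ ℚ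
  have hζ := IsCyclotomicExtension.zeta_spec (p ^ (l + 1)) ℚ K
  obtain ⟨σ, hσ⟩ := exists_ringHom_toInteger_mul_eq_one hζ
  have hN : hζ.toInteger ^ (2 * p ^ (l + 1) * v) = 1 := by
    rw [mul_right_comm, pow_mul', hζ.toInteger_isPrimitiveRoot.pow_eq_one, one_pow]
  have hN' : (-hζ.toInteger) ^ (2 * p ^ (l + 1) * v) = 1 := by
    rwa [Even.neg_pow (by simp [mul_assoc])]
  obtain ⟨i, hi⟩ := ha.exists_charSum_ne_zero hN
  contrapose! hi with hlt
  have hparity (e : Fin 2) :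
      ∑ j with j.val % 2 = e.val, (a i j : 𝓞 K) * hζ.toInteger ^ (j : ℕ) = 0 := by
    refine (ha.1 i).sum_eq_zero_of_dvd hζ (v := v) (M := p ^ k)
      (fun k hk => card_filter_parity_mod_eq hp2.pow hk e) ?_ ?_
    · rw [(Nat.coprime_two_left.2 hp2.pow).lcm_eq_mul]
      lia
    · have hcop : IsCoprime ((p ^ k : ℕ) : 𝓞 K) 2 := by
        exact_mod_cast Nat.Coprime.cast (Nat.coprime_two_right.2 hp2.pow)
      refine hcop.dvd_of_dvd_mul_left ?_
      rw [two_mul_sum_parity]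
      push_cast
      exact (ha.natCast_pow_dvd_charSum hζ hr hk hσ hN hσ i).add
        ((ha.natCast_pow_dvd_charSum hζ hr hk hσ hN' (by simpa using hσ) i).mul_left _)
  have hsplit : charSum (a i) hζ.toInteger = _ :=
    (Finset.sum_fiberwise Finset.univ (fun j => Fin.ofNat 2 j.val) _).symm
  rw [hsplit]
  refine Finset.sum_eq_zero fun e _ => ?_
  rw [← hparity e]
  exact Finset.sum_congr (by simp [Fin.ext_iff]) fun _ _ => rfl

end Cyclotomic

theorem not_existsPCS_one_sixteen : ¬ ExistsPCS 1 16 := fun h =>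
  absurd (h.lcm_two_pow_le (p := 2) (l := 3) (u := 1) (k := 2)
    (sumSqAnisotropic_of_unique (Fin 1) 2) (by decide)) (by decide)

theorem not_existsPCS_two_thirtySix : ¬ ExistsPCS 2 36 := fun h =>
  absurd (h.pow_le_of_odd (p := 3) (l := 1) (v := 2) (k := 1) (by decide)
    (by unfold SumSqAnisotropic; decide) (by decide)) (by decide)

/-! ### Parity of the length -/

theorem IsBinary.pacf_modEq {N : ℕ} {a : Fin N → ℤ} (ha : IsBinary a) (i : Fin N) :
    pacf a i ≡ N [ZMOD 4] := by
  have : NeZero N := ⟨i.pos.ne'⟩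
  have htwo (j : Fin N) : 2 ∣ a j - 1 := by simpa using ha.two_dvd_sum_sub_card {j}
  have hsum : 2 ∣ ∑ j, a j - N := by simpa using ha.two_dvd_sum_sub_card Finset.univ
  have hprod : (2 * 2 : ℤ) ∣ ∑ j, (a j - 1) * (a (i + j) - 1) :=
    Finset.dvd_sum fun j _ => mul_dvd_mul (htwo j) (htwo (i + j))
  have hexpand : ∑ j, (a j - 1) * (a (i + j) - 1) = pacf a i - N - 2 * (∑ j, a j - N) := by
    have hshift : ∑ j, a (i + j) = ∑ j, a j := Equiv.sum_comp (Equiv.addLeft i) a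
    simp only [sub_mul, mul_sub, one_mul, mul_one, Finset.sum_sub_distrib, hshift, pacf,
      Finset.sum_const, Finset.card_univ, Fintype.card_fin, nsmul_eq_mul]
    ring
  rw [hexpand] at hprod
  exact (Int.modEq_iff_dvd.2 ((dvd_sub_left (mul_dvd_mul_left 2 hsum)).1 hprod)).symm

theorem ExistsPCS.four_dvd_mul {p N : ℕ} (hN : 1 < N) (h : ExistsPCS p N) : 4 ∣ p * N := by
  obtain ⟨a, ha, hsum⟩ := h
  have hmod : ∑ r, pacf (a r) ⟨1, hN⟩ ≡ ∑ _r : Fin p, (N : ℤ) [ZMOD 4] :=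
    Int.ModEq.sum fun r _ => (ha r).pacf_modEq _
  rw [hsum ⟨1, hN⟩ one_ne_zero, Fin.sum_const, nsmul_eq_mul] at hmod
  exact_mod_cast Int.modEq_zero_iff_dvd.1 hmod.symm

theorem ExistsPCS.even {p N : ℕ} (hp : ¬ 4 ∣ p) (hN : 1 < N) (h : ExistsPCS p N) : Even N := by
  contrapose! hp with hodd
  have hcop : Nat.Coprime (2 ^ 2) N :=
    (Nat.coprime_two_left.2 (Nat.not_even_iff_odd.1 hodd)).pow_left 2
  exact hcop.dvd_of_dvd_mul_right (h.four_dvd_mul hN)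

/-! ### Combining families and doubling the length -/

theorem ExistsPCS.add {p q N : ℕ} (hp : ExistsPCS p N) (hq : ExistsPCS q N) :
    ExistsPCS (p + q) N := by
  obtain ⟨a, ha, ha'⟩ := hp
  obtain ⟨b, hb, hb'⟩ := hq
  refine ⟨Fin.append a b, fun r => ?_, fun i hi => ?_⟩
  · refine Fin.addCases (fun r => ?_) (fun r => ?_) r
    · simpa using ha r
    · simpa using hb r
  · simp [Fin.sum_univ_add, ha' i hi, hb' i hi]

theorem existsPCS_zero (N : ℕ) : ExistsPCS 0 N :=
  ⟨fun _ _ => 1, fun r => r.elim0, by simp⟩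

theorem existsPCS_one_right (p : ℕ) : ExistsPCS p 1 :=
  ⟨fun _ _ => 1, fun _ _ => Or.inl rfl, fun i hi => (hi (by omega)).elim⟩

theorem ExistsPCS.mul_left {p N : ℕ} (h : ExistsPCS p N) (k : ℕ) : ExistsPCS (k * p) N := by
  induction k with
  | zero => simpa using existsPCS_zero N
  | succ k ih => rw [Nat.succ_mul]; exact ih.add h

theorem existsPCS_multiset_sum {N : ℕ} (s : Multiset ℕ) (h : ∀ q ∈ s, ExistsPCS q N) :
    ExistsPCS s.sum N := by
  induction s using Multiset.induction with
  | empty => simpa using existsPCS_zero N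
  | cons q s ih =>
    rw [Multiset.sum_cons]
    exact (h q (by simp)).add (ih fun r hr => h r (by simp [hr]))

/-- The sequence with the terms of `a` at the even places and those of `b` at the odd places. -/
def interleave {N : ℕ} (a b : Fin N → ℤ) (n : Fin (N * 2)) : ℤ :=
  if (n : ℕ) % 2 = 0 then a n.divNat else b n.divNat

theorem IsBinary.interleave {N : ℕ} {a b : Fin N → ℤ} (ha : IsBinary a) (hb : IsBinary b) :
    IsBinary (interleave a b) := fun n => by
  unfold PeriodicComplementary.interleave
  split_ifs
  exacts [ha _, hb _]

theorem IsBinary.neg {N : ℕ} {a : Fin N → ℤ} (ha : IsBinary a) : IsBinary (-a) := fun n => by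
  rcases ha n with h | h <;> simp [h]

theorem val_add_mod_two {N : ℕ} (i j : Fin (N * 2)) :
    ((i + j : Fin (N * 2)) : ℕ) % 2 = (i + j : ℕ) % 2 := by
  rw [Fin.val_add, Nat.mod_mod_of_dvd _ (Dvd.intro_left N rfl)]

theorem pacf_interleave_odd {N : ℕ} (a b : Fin N → ℤ) {i : Fin (N * 2)} (hi : (i : ℕ) % 2 = 1) :
    pacf (interleave a b) i + pacf (interleave a (-b)) i = 0 := by
  simp only [pacf, ← Finset.sum_add_distrib]
  refine Finset.sum_eq_zero fun j _ => ?_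
  have h := val_add_mod_two i j
  rcases Nat.mod_two_eq_zero_or_one j with hj | hj
  · have h' : ((i + j : Fin (N * 2)) : ℕ) % 2 = 1 := by omega
    simp [interleave, hj, h']
  · have h' : ((i + j : Fin (N * 2)) : ℕ) % 2 = 0 := by omega
    simp [interleave, hj, h']

theorem divNat_add_of_even {N : ℕ} {i : Fin (N * 2)} (hi : (i : ℕ) % 2 = 0) (j : Fin (N * 2)) :
    (i + j).divNat = i.divNat + j.divNat := by
  ext
  simp only [Fin.coe_divNat, Fin.val_add]
  have h := Nat.mod_mul_right_div_self (i + j : ℕ) 2 N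
  rw [Nat.mul_comm 2 N] at h
  rw [h]
  congr 1
  omega

theorem pacf_interleave_even {N : ℕ} (a b : Fin N → ℤ) {i : Fin (N * 2)} (hi : (i : ℕ) % 2 = 0) :
    pacf (interleave a b) i = pacf a i.divNat + pacf b i.divNat := by
  have key : ∀ j : Fin (N * 2), interleave a b j * interleave a b (i + j) =
      if (j : ℕ) % 2 = 0 then a j.divNat * a (i.divNat + j.divNat)
      else b j.divNat * b (i.divNat + j.divNat) := fun j => by
    have h := val_add_mod_two i j
    rcases Nat.mod_two_eq_zero_or_one j with hj | hj
    · have h' : ((i + j : Fin (N * 2)) : ℕ) % 2 = 0 := by omega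
      simp [interleave, hj, h', divNat_add_of_even hi]
    · have h' : ((i + j : Fin (N * 2)) : ℕ) % 2 = 1 := by omega
      simp [interleave, hj, h', divNat_add_of_even hi]
  have hdiv : ∀ (q : Fin N) (e : Fin 2), (finProdFinEquiv (q, e)).divNat = q := fun q e =>
    congrArg Prod.fst (finProdFinEquiv.symm_apply_apply (q, e))
  rw [pacf, Finset.sum_congr rfl fun j _ => key j, ← Equiv.sum_comp finProdFinEquiv,
    Fintype.sum_prod_type]
  simp only [Fin.sum_univ_two, hdiv, Finset.sum_add_distrib, pacf]
  simp [finProdFinEquiv, Nat.add_mod]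

theorem ExistsPCS.double_length {k N : ℕ} (h : ExistsPCS (k * 2) N) :
    ExistsPCS (k * 2) (N * 2) := by
  obtain ⟨a, ha, hsum⟩ := h
  let b : Fin k × Fin 2 → Fin N → ℤ := fun x => a (finProdFinEquiv x)
  let c : Fin k × Fin 2 → Fin (N * 2) → ℤ := fun x =>
    interleave (b (x.1, 0)) (if x.2 = 0 then b (x.1, 1) else -b (x.1, 1))
  have hc (i : Fin (N * 2)) : ∑ r, pacf (c (finProdFinEquiv.symm r)) i =
      ∑ x, (pacf (interleave (b (x, 0)) (b (x, 1))) i +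
        pacf (interleave (b (x, 0)) (-b (x, 1))) i) := by
    rw [Equiv.sum_comp finProdFinEquiv.symm fun x => pacf (c x) i, Fintype.sum_prod_type]
    simp only [c, Fin.sum_univ_two, if_true, one_ne_zero, if_false]
  refine ⟨fun r => c (finProdFinEquiv.symm r), fun r => ?_, fun i hi => ?_⟩
  · simp only [c]
    split_ifs
    exacts [(ha _).interleave (ha _), (ha _).interleave (ha _).neg]
  · rw [hc]
    rcases Nat.mod_two_eq_zero_or_one i with heven | hodd
    · have hdiv : (i.divNat : ℕ) ≠ 0 := by
        rw [Fin.coe_divNat]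
        lia
      have hneg (x : Fin k) : pacf (-b (x, 1)) i.divNat = pacf (b (x, 1)) i.divNat := by
        simp [pacf]
      have hb := hsum i.divNat hdiv
      rw [← Equiv.sum_comp finProdFinEquiv, Fintype.sum_prod_type] at hb
      simp only [Fin.sum_univ_two] at hb
      simp only [pacf_interleave_even _ _ heven, hneg]
      rw [Finset.sum_add_distrib, hb, add_zero]
    · exact Finset.sum_eq_zero fun x _ => pacf_interleave_odd _ _ hodd

/-! ### Supplementary difference sets -/

theorem nu_eq_sum {N : ℕ} (X : Finset (Fin N)) (m : Fin N) :
    (nu X m : ℤ) = ∑ j, (if j ∈ X then 1 else 0) * (if m + j ∈ X then 1 else 0) := by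
  have hN : NeZero N := ⟨by rintro rfl; exact m.elim0⟩
  simp only [← ite_and, mul_ite, mul_one, mul_zero, Finset.sum_boole, Nat.cast_inj]
  refine Finset.card_bij' (fun ij _ => ij.2) (fun j _ => (m + j, j)) ?_ ?_ ?_ ?_
  · rintro ⟨i, j⟩ h
    simp only [Finset.mem_filter, Finset.mem_product, sub_eq_iff_eq_add] at h
    simp [← h.2, h.1]
  · intro j h
    simp only [Finset.mem_filter, Finset.mem_univ, true_and] at h
    simp [h]
  · rintro ⟨i, j⟩ h
    simp only [Finset.mem_filter, Finset.mem_product, sub_eq_iff_eq_add] at h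
    simp [← h.2]
  · simp

theorem existsPCS_of_sum_nu_eq {p N : ℕ} (X : Fin p → Finset (Fin N))
    (h : ∀ m : Fin N, (m : ℕ) ≠ 0 → p * N + 4 * ∑ r, nu (X r) m = 4 * ∑ r, (X r).card) :
    ExistsPCS p N := by
  refine ⟨fun r j => 1 - 2 * (if j ∈ X r then 1 else 0), fun r j => ?_, fun i hi => ?_⟩
  · by_cases hj : j ∈ X r <;> simp [hj]
  have hpacf (r : Fin p) : pacf (fun j => (1 : ℤ) - 2 * (if j ∈ X r then 1 else 0)) i =
      N - 4 * (X r).card + 4 * nu (X r) i := by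
    have : NeZero N := ⟨i.pos.ne'⟩
    have hcard : ∑ j, (if j ∈ X r then (1 : ℤ) else 0) = (X r).card := by simp
    have hshift : ∑ j, (if i + j ∈ X r then (1 : ℤ) else 0) = (X r).card :=
      (Equiv.sum_comp (Equiv.addLeft i) fun j => if j ∈ X r then (1 : ℤ) else 0).trans hcard
    have hexpand (x y : ℤ) : (1 - 2 * x) * (1 - 2 * y) = 1 - 2 * x - 2 * y + 4 * (x * y) := by
      ring
    simp only [pacf, hexpand, Finset.sum_add_distrib, Finset.sum_sub_distrib, ← Finset.mul_sum,
      hcard, hshift, ← nu_eq_sum, Fin.sum_const, nsmul_one]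
    ring
  have hi := h i hi
  zify at hi
  simp only [hpacf, Finset.sum_add_distrib, Finset.sum_sub_distrib, ← Finset.mul_sum,
    Fin.sum_const, nsmul_eq_mul]
  linarith

/-- The set encoded by the bit mask `x`: the positions below `N` of its binary digits `1`. This
encoding keeps the verification of explicit sets within reach of kernel evaluation. -/
def digitSet (N x : ℕ) : Finset (Fin N) :=
  Finset.univ.filter fun j => x.testBit j

/-- The periodic autocorrelation, at the shift `m`, of the first `N` binary digits of `x`. -/
def digitCorrelation (N x m : ℕ) : ℕ :=
  Nat.count (fun j => x.testBit j ∧ x.testBit ((m + j) % N)) N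

theorem card_digitSet (N x : ℕ) : (digitSet N x).card = Nat.count (x.testBit ·) N :=
  card_filter_val_eq_count N fun j => x.testBit j

theorem nu_digitSet {N : ℕ} (x : ℕ) (m : Fin N) :
    nu (digitSet N x) m = digitCorrelation N x m := by
  zify
  rw [nu_eq_sum, digitCorrelation, ← card_filter_val_eq_count]
  simp [digitSet, ← ite_and, Fin.val_add, and_comm]

/-- Bit masks of `p` supplementary difference sets in `ℤ / N`, and `0` where no such sets are
recorded. For `p = 4` the column `N` ranges over the odd numbers, for the other `p` over the bullet
entries of the table except those that arise from shorter ones by doubling the length. -/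
def sdsDigits : (p N : ℕ) → Fin p → ℕ
  | 1, 4 => ![1]
  | 2, 2 => ![0, 1]
  | 2, 10 => ![83, 11]
  | 2, 26 => ![832629, 562747]
  | 2, 34 => ![41584451, 623273431]
  | 2, 50 => ![672301318151860, 881117297447472]
  | 3, 8 => ![7, 37, 17]
  | 3, 12 => ![7, 427, 619]
  | 3, 16 => ![215, 2443, 2707]
  | 3, 24 => ![3417251, 225508, 13714357]
  | 3, 28 => ![38077207, 134963641, 75738481]
  | 3, 32 => ![2821399832, 1216823170, 610943971]
  | 3, 36 => ![51557341839, 37858616169, 8095304409]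
  | 3, 40 => ![618041854786, 434265715562, 659319702004]
  | 3, 44 => ![7927464742963, 7435352449295, 6741506954527]
  | 3, 48 => ![1543652094908, 119486084308213, 248706708328553]
  | 4, 3 => ![0, 2, 4, 2]
  | 4, 5 => ![1, 8, 24, 18]
  | 4, 7 => ![36, 34, 80, 97]
  | 4, 9 => ![268, 44, 322, 304]
  | 4, 11 => ![266, 1176, 705, 158]
  | 4, 13 => ![201, 3240, 4153, 2571]
  | 4, 15 => ![12880, 18467, 21104, 15633]
  | 4, 17 => ![38022, 16775, 33205, 100491]
  | 4, 19 => ![110690, 168071, 182080, 283062]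
  | 4, 21 => ![658758, 741414, 28428, 625546]
  | 4, 23 => ![2344966, 5850630, 481923, 2410589]
  | 4, 25 => ![32153672, 13633477, 13791524, 21777505]
  | 4, 27 => ![4564268, 106456612, 24682610, 60823004]
  | 4, 29 => ![454040260, 177483360, 246973005, 423379779]
  | 4, 31 => ![1242587388, 226906822, 111718212, 1489544219]
  | 4, 33 => ![8206274578, 5114564192, 120306209, 2795980428]
  | 4, 35 => ![21583790160, 3465924615, 12995179114, 7328264298]
  | 4, 37 => ![18591370161, 40484616577, 70583550099, 62875009671]
  | 4, 39 => ![138097089555, 124571342217, 437031323858, 63944075412]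
  | 4, 41 => ![56191216528, 1596204581125, 2071848068680, 1868807922722]
  | 4, 43 => ![2225382271285, 3885659931459, 4575475401321, 8686645024131]
  | 4, 45 => ![12068195419024, 12170278800848, 2991768675973, 31344169368180]
  | 4, 47 => ![36184032359100, 37943140963254, 116449697932291, 137257676752040]
  | 4, 49 => ![177043343150965, 401328347131672, 404907015648065, 53941125178208]
  | 5, 12 => ![11, 2569, 1125, 1588, 3342]
  | 5, 20 => ![352774, 297801, 116528, 557678, 722768]
  | 5, 24 => ![8403653, 8562970, 3736607, 3453489, 14758956]
  | 5, 28 => ![40541232, 149606410, 41042236, 20146608, 208680360]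
  | 5, 36 => ![39737637437, 64899653122, 9471955386, 25856201933, 42968222970]
  | 5, 44 => ![6332233479494, 449144118646, 9846312558852, 6702637314638, 4638766493345]
  | 5, 48 => ![184696050840896, 177795444269905, 19641357131986, 225064446595146, 142272541606248]
  | 6, 6 => ![4, 5, 36, 3, 40, 48]
  | 6, 14 => ![6466, 7177, 8970, 4380, 6736, 14016]
  | 6, 18 => ![26824, 102538, 184334, 41174, 91399, 181489]
  | 6, 22 => ![3409995, 2543873, 156249, 2370183, 2259170, 181463]
  | 6, 30 => ![303416490, 842016403, 1008014364, 965677092, 135159433, 601439056]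
  | 6, 38 => ![23313655930, 51884247542, 5523768781, 182044476984, 34715143278, 156231796983]
  | 6, 42 => ![1388018282746, 2683772355400, 3656490590272, 1371222323362, 277966793422,
      14715755315]
  | 6, 46 => ![2118850040353, 54480975857158, 59599052876678, 4470768628015, 58518976401046,
      52811596737545]
  | _, _ => 0

theorem existsSDS_of_sdsDigits {p N : ℕ} {k : Fin p → ℕ} {l : ℕ}
    (hk : ∀ r, Nat.count ((sdsDigits p N r).testBit ·) N = k r)
    (hl : ∀ m < N, m ≠ 0 → ∑ r, digitCorrelation N (sdsDigits p N r) m = l) : ExistsSDS N k l :=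
  ⟨fun r => digitSet N (sdsDigits p N r), fun r => (card_digitSet N _).trans (hk r),
    fun m hm => by simp only [nu_digitSet, hl m m.2 hm]⟩

set_option synthInstance.maxSize 2000 in
theorem sum_digitCorrelation_sdsDigits : ∀ p < 7, ∀ N < 51, sdsDigits p N ≠ 0 → ∀ m < N, m ≠ 0 →
    p * N + 4 * ∑ r, digitCorrelation N (sdsDigits p N r) m =
      4 * ∑ r, Nat.count ((sdsDigits p N r).testBit ·) N := by
  decide +kernel

theorem existsPCS_of_sdsDigits_ne_zero {p N : ℕ} (hp : p < 7) (hN : N < 51)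
    (h : sdsDigits p N ≠ 0) : ExistsPCS p N :=
  existsPCS_of_sum_nu_eq (fun r => digitSet N (sdsDigits p N r)) fun m hm => by
    simpa only [nu_digitSet, card_digitSet] using
      sum_digitCorrelation_sdsDigits p hp N hN h m m.2 hm

/-! ### Existence -/

theorem existsPCS_four {N : ℕ} (hN0 : 1 ≤ N) (hN : N ≤ 50) : ExistsPCS 4 N := by
  have hodd : ∀ k < 25, k ≠ 0 → sdsDigits 4 (2 * k + 1) ≠ 0 := by decide +kernel
  induction N using Nat.strong_induction_on with
  | _ N ih =>
    rcases Nat.even_or_odd' N with ⟨k, rfl | rfl⟩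
    · rw [Nat.mul_comm]
      exact (ih k (by lia) (by lia) (by lia)).double_length (k := 2)
    · rcases eq_or_ne k 0 with rfl | hk
      · exact existsPCS_one_right 4
      · exact existsPCS_of_sdsDigits_ne_zero (by decide) (by lia) (hodd k (by lia) hk)

theorem existsPCS_of_four_dvd {p N : ℕ} (hp : 4 ∣ p) (hN0 : 1 ≤ N) (hN : N ≤ 50) :
    ExistsPCS p N := by
  obtain ⟨k, rfl⟩ := hp
  rw [Nat.mul_comm]
  exact (existsPCS_four hN0 hN).mul_left k

theorem existsPCS_two_of_mem {N : ℕ} (h : N ∈ [8, 16, 20, 32, 40]) : ExistsPCS 2 N := by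
  have hdouble {M : ℕ} (hM : ExistsPCS 2 M) : ExistsPCS 2 (M * 2) := hM.double_length (k := 1)
  have h2 : ExistsPCS 2 2 :=
    existsPCS_of_sdsDigits_ne_zero (by decide) (by decide) (by decide)
  have h10 : ExistsPCS 2 10 :=
    existsPCS_of_sdsDigits_ne_zero (by decide) (by decide) (by decide)
  have h8 : ExistsPCS 2 8 := hdouble (hdouble h2)
  have h20 : ExistsPCS 2 20 := hdouble h10
  simp only [List.mem_cons, List.not_mem_nil, or_false] at h
  rcases h with rfl | rfl | rfl | rfl | rfl
  exacts [h8, hdouble h8, h20, hdouble (hdouble h8), hdouble h20]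

theorem lt_seven_of_mem_bulletColumns {p N : ℕ} (h : N ∈ bulletColumns p) : p < 7 := by
  unfold bulletColumns at h
  split at h <;> simp at h ⊢

theorem existsPCS_of_bullet {p N : ℕ} (h : tableEntry p N = .bullet) : ExistsPCS p N := by
  have hcolumns : ∀ p < 7, ∀ N ∈ bulletColumns p,
      N < 51 ∧ (sdsDigits p N ≠ 0 ∨ p = 2 ∧ N ∈ [8, 16, 20, 32, 40]) := by
    decide +kernel
  unfold tableEntry at h
  split_ifs at h with hmem
  have hp := lt_seven_of_mem_bulletColumns hmem
  obtain ⟨hN, hsds | ⟨rfl, hN2⟩⟩ := hcolumns p hp N hmem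
  exacts [existsPCS_of_sdsDigits_ne_zero hp hN hsds, existsPCS_two_of_mem hN2]

/-! ### Combinations -/

theorem IsCombination.existsPCS {p N : ℕ} (hN0 : 1 ≤ N) (hN : N ≤ 50) (h : IsCombination p N) :
    ExistsPCS p N := by
  obtain ⟨s, rfl, hs⟩ := h
  refine existsPCS_multiset_sum s fun q hq => ?_
  rcases (hs q hq).2 with rfl | hb
  exacts [existsPCS_four hN0 hN, existsPCS_of_bullet hb]

set_option synthInstance.maxSize 2000 in
theorem isCombination_of_circle {p N : ℕ} (hp : p ≤ 12) (hN : N ≤ 50)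
    (h : tableEntry p N = .circle) : IsCombination p N := by
  have hparts : ∀ p < 13, ∀ N < 51, tableEntry p N = .circle →
      ∃ l ∈ [[1, 1], [1, 1, 1], [1, 4], [2, 3], [2, 2, 2], [1, 1, 1, 1, 1, 1], [3, 3],
        [1, 1, 1, 4], [3, 4], [2, 5], [1, 4, 4], [3, 3, 3], [4, 5], [4, 6], [2, 2, 2, 4],
        [3, 3, 4], [1, 1, 4, 4], [3, 4, 4], [2, 4, 5], [1, 1, 1, 4, 4]],
        l.sum = p ∧ ∀ q ∈ l, q < p ∧ (q = 4 ∨ tableEntry q N = .bullet) := by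
    decide +kernel
  obtain ⟨l, -, hl, hq⟩ := hparts p (by lia) N (by lia) h
  exact ⟨l, by simpa using hl, by simpa using hq⟩

set_option synthInstance.maxSize 2000 in
theorem combination_obstruction_of_bullet : ∀ p < 13, ∀ N < 51, tableEntry p N = .bullet →
    (∃ d ∈ [2, 4], ¬ d ∣ p ∧ ∀ q < p, (q = 4 ∨ tableEntry q N = .bullet) → d ∣ q) ∨
    p = 5 ∧ ∀ q < p, (q = 4 ∨ tableEntry q N = .bullet) → 3 ≤ q ∧ q ≤ 4 := by
  decide +kernel

theorem not_isCombination_of_bullet {p N : ℕ} (hp : p ≤ 12) (hN : N ≤ 50)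
    (h : tableEntry p N = .bullet) : ¬ IsCombination p N := by
  rintro ⟨s, hs, hq⟩
  rcases combination_obstruction_of_bullet p (by lia) N (by lia) h with
    ⟨d, -, hdp, hd⟩ | ⟨rfl, hbounds⟩
  · exact hdp (hs ▸ Multiset.dvd_sum fun q hqs => hd q (hq q hqs).1 (hq q hqs).2)
  · have hlower := s.card_nsmul_le_sum fun q hqs => (hbounds q (hq q hqs).1 (hq q hqs).2).1
    have hupper := s.sum_le_card_nsmul 4 fun q hqs => (hbounds q (hq q hqs).1 (hq q hqs).2).2
    simp only [hs, smul_eq_mul] at hlower hupper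
    lia

/-! ### Blank entries -/

theorem not_existsPCS_two_eighteen : ¬ ExistsPCS 2 18 := fun h =>
  not_existsPCS_two_thirtySix (h.double_length (k := 1))

theorem not_existsPCS_one_thirtySix : ¬ ExistsPCS 1 36 := fun h =>
  not_existsPCS_two_thirtySix (h.add h)

theorem not_existsPCS_three_twenty : ¬ ExistsPCS 3 20 := fun h => by
  obtain ⟨x, hx⟩ := h.exists_sum_sq_eq
  rw [Fin.sum_univ_three] at hx
  have hsq : ∀ u < 8, ∀ v < 8, ∀ w < 8, u ^ 2 + v ^ 2 + w ^ 2 ≠ 3 * 20 := by decide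
  exact hsq (x 0) (by nlinarith) (x 1) (by nlinarith) (x 2) (by nlinarith) hx

set_option synthInstance.maxSize 2000 in
theorem eq_of_existsPCS_one {N : ℕ} (hN1 : 1 < N) (hN : N ≤ 50) (heven : Even N)
    (h : ExistsPCS 1 N) : N = 4 ∨ N = 16 ∨ N = 36 := by
  have : NeZero N := ⟨by lia⟩
  obtain ⟨x, hx⟩ := h.exists_sum_sq_eq
  rw [Fin.sum_univ_one] at hx
  have hsq : ∀ u < 8, ∀ N < 51, 1 < N → Even N → u ^ 2 = 1 * N → N = 4 ∨ N = 16 ∨ N = 36 := by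
    decide +kernel
  exact hsq (x 0) (by nlinarith) N (by lia) hN1 heven hx

set_option synthInstance.maxSize 2000 in
theorem mem_of_existsPCS_two {N : ℕ} (hN1 : 1 < N) (hN : N ≤ 50) (heven : Even N)
    (h : ExistsPCS 2 N) : N ∈ bulletColumns 2 ∨ N = 4 ∨ N = 18 ∨ N = 36 := by
  have : NeZero N := ⟨by lia⟩
  obtain ⟨x, hx⟩ := h.exists_sum_sq_eq
  rw [Fin.sum_univ_two] at hx
  have hsq : ∀ u < 11, ∀ v < 11, ∀ N < 51, 1 < N → Even N → u ^ 2 + v ^ 2 = 2 * N →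
      N ∈ bulletColumns 2 ∨ N = 4 ∨ N = 18 ∨ N = 36 := by
    decide +kernel
  exact hsq (x 0) (by nlinarith) (x 1) (by nlinarith) N (by lia) hN1 heven hx

set_option synthInstance.maxSize 2000 in
theorem eq_of_blank_of_four_dvd_mul : ∀ p < 13, ∀ N < 51, ¬ 4 ∣ p → 1 < N → Even N →
    tableEntry p N = .blank → 4 ∣ p * N → p = 1 ∨ p = 2 ∨ p = 3 ∧ N = 20 := by
  decide +kernel

theorem not_existsPCS_of_blank {p N : ℕ} (hp : p ≤ 12) (h4 : ¬ 4 ∣ p) (hN1 : 1 < N) (hN : N ≤ 50)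
    (heven : Even N) (hb : tableEntry p N = .blank) : ¬ ExistsPCS p N := by
  intro h
  rcases eq_of_blank_of_four_dvd_mul p (by lia) N (by lia) h4 hN1 heven hb
    (h.four_dvd_mul hN1) with rfl | rfl | ⟨rfl, rfl⟩
  · rcases eq_of_existsPCS_one hN1 hN heven h with rfl | rfl | rfl
    · exact absurd hb (by decide)
    · exact not_existsPCS_one_sixteen h
    · exact not_existsPCS_one_thirtySix h
  · rcases mem_of_existsPCS_two hN1 hN heven h with hmem | rfl | rfl | rfl
    · simp [tableEntry, hmem] at hb
    · exact absurd hb (by decide)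
    · exact not_existsPCS_two_eighteen h
    · exact not_existsPCS_two_thirtySix h
  · exact not_existsPCS_three_twenty h

end PeriodicComplementary

theorem mainTheorem1 :
    -- rows with `4 ∣ p`: always existence
    (∀ p N : ℕ, 1 ≤ p → 4 ∣ p → 1 ≤ N → N ≤ 50 → ExistsPCS p N) ∧
    -- length one: always existence
    (∀ p : ℕ, 1 ≤ p → ExistsPCS p 1) ∧
    -- otherwise the length has to be even
    (∀ p N : ℕ, ¬ 4 ∣ p → 1 < N → ExistsPCS p N → Even N) ∧
    -- the table decides existence for even lengths
    (∀ p N : ℕ, 1 ≤ p → p ≤ 12 → ¬ 4 ∣ p → 1 < N → N ≤ 50 → Even N →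
      (tableEntry p N = .blank → ¬ ExistsPCS p N) ∧
      (tableEntry p N = .bullet → ExistsPCS p N ∧ ¬ IsCombination p N) ∧
      (tableEntry p N = .circle → ExistsPCS p N ∧ IsCombination p N)) ∧
    -- the supplementary difference sets that settle the formerly undecided cases
    (ExistsSDS 36 ![15, 15, 15] 18 ∧
      ExistsSDS 40 ![19, 18, 15] 22 ∧
      ExistsSDS 44 ![20, 20, 17] 24 ∧
      ExistsSDS 48 ![24, 24, 18] 30 ∧
      ExistsSDS 44 ![21, 20, 19, 18, 17] 40 ∧
      ExistsSDS 48 ![23, 21, 21, 20, 19] 44 ∧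
      ExistsSDS 38 ![18, 17, 16, 16, 16, 14] 40 ∧
      ExistsSDS 42 ![19, 18, 18, 18, 17, 17] 44 ∧
      ExistsSDS 46 ![21, 21, 21, 21, 21, 16] 52) := by
  refine ⟨fun p N _ hp hN1 hN => existsPCS_of_four_dvd hp hN1 hN, fun p _ => existsPCS_one_right p,
    fun p N hp hN h => h.even hp hN,
    fun p N _ hp h4 hN1 hN heven => ⟨fun h => ?blank, fun h => ?bullet, fun h => ?circle⟩,
    ?sds⟩
  case blank => exact not_existsPCS_of_blank hp h4 hN1 hN heven h
  case bullet => exact ⟨existsPCS_of_bullet h, not_isCombination_of_bullet hp hN h⟩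
  case circle =>
    have hcomb := isCombination_of_circle hp hN h
    exact ⟨hcomb.existsPCS hN1.le hN, hcomb⟩
  case sds =>
    refine ⟨?_, ?_, ?_, ?_, ?_, ?_, ?_, ?_, ?_⟩ <;>
      exact existsSDS_of_sdsDigits (by decide +kernel) (by decide +kernel)
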